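/- A \emph{forcing} is a continuous function $\phi:\mathbb{R}\to\mathbb{R}$ with $\phi(x+1)=\phi(x)$, and its $(\omega,b)$-family is $\tilde f_{b,\omega,\phi}(x)=x+\omega+b\,\phi(x)$, $\omega\in\mathbb{R}$, $b\ge 0$ (lifts of degree-one maps of the circle $S^1=\mathbb{R}/\mathbb{Z}$). The forcing $\phi$ is \emph{standard-like} if, for every $\omega$, $\tilde f_{b,\omega,\phi}$ is strictly increasing whenever $0\le b<1$ and is not non-decreasing whenever $b>1$. For $k\ge 1$ let $\mathcal{S}^{PL}_k$ be the set of standard-like piecewise linear forcings with exactly $k$ break points on the circle, i.e. those $\phi$ for which there are lifts $x_0<x_1<\dots<x_{k-1}<x_k:=x_0+1$ of $k$ points of $S^1$ and slopes $w_0,\dots,w_{k-1}$, with cyclically adjacent slopes different, such that $\phi$ is affine with slope $w_i$ on $[x_i,x_{i+1}]$. Topologize $\mathcal{S}^{PL}_k$ by the positions of the break points, the slopes, and the additive constant: it carries the quotient topology from the space of all admissible tuples $(x_0,\dots,x_{k-1},w_0,\dots,w_{k-1},\phi(x_0))\in\mathbb{R}^{2k+1}$ under the map that sends a tuple to the forcing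 it describes. For coprime $p\in\mathbb{Z}$ and $q\ge 1$, the $p/q$-tongue in the $(\omega,b)$-family of $\phi$ is \emph{pinched} at $(\omega,b)$, $b>0$, if $\tilde f_{b,\omega,\phi}^{\,q}(x)=x+p$ for all $x\in\mathbb{R}$. \textbf{Theorem.} Let $k>2$. The set of all $\phi\in\mathcal{S}^{PL}_k$ such that no $p/q$-tongue ($p\in\mathbb{Z}$, $q\ge 1$, $\gcd(p,q)=1$) in the $(\omega,b)$-family of $\phi$ is pinched at any $(\omega,b)$ with $\omega\in\mathbb{R}$ and $b>0$ is a dense $G_\delta$ subset of $\mathcal{S}^{PL}_k$. -/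

import Mathlib

/-- The lift `x ↦ x + ω + b φ(x)` of the member of the `(ω, b)`-family of the forcing `φ`. -/
def circleFamily (b ω : ℝ) (φ : ℝ → ℝ) (x : ℝ) : ℝ := x + ω + b * φ x

/-- Standard-like forcings: for couplings `0 ≤ b < 1` the family is strongly order preserving,
and for `b > 1` it is not even weakly order preserving. -/
structure IsStandardLike (φ : ℝ → ℝ) : Prop where
  strictMono_of_lt_one : ∀ b ω : ℝ, 0 ≤ b → b < 1 → StrictMono (circleFamily b ω φ)
  not_monotone_of_one_lt : ∀ b ω : ℝ, 1 < b → ¬ Monotone (circleFamily b ω φ)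

/-- `φ` is piecewise linear with exactly `k` break points per period.  The break points on the
circle `ℝ / ℤ` are listed through all their lifts `⋯ < x (-1) < x 0 < x 1 < ⋯` to `ℝ`, so that
`x (i + k) = x i + 1`, and `w i` is the slope of `φ` on `[x i, x (i + 1)]`; adjacent slopes differ,
so every `x i` is a true break point. -/
structure IsPLWith (k : ℕ) (φ : ℝ → ℝ) (x w : ℤ → ℝ) : Prop where
  strictMono : StrictMono x
  break_add : ∀ i : ℤ, x (i + k) = x i + 1
  slope_add : ∀ i : ℤ, w (i + k) = w i
  slope_ne : ∀ i : ℤ, w (i + 1) ≠ w i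
  affine : ∀ i : ℤ, ∀ t ∈ Set.Icc (x i) (x (i + 1)), φ t = φ (x i) + w i * (t - x i)

/-- The space of standard-like piecewise linear forcings on the circle `ℝ / ℤ` (as 1-periodic
functions on `ℝ`) with exactly `k` break points. -/
structure PLForcing (k : ℕ) where
  toFun : ℝ → ℝ
  periodic : Function.Periodic toFun 1
  exists_isPLWith : ∃ x w : ℤ → ℝ, IsPLWith k toFun x w
  standardLike : IsStandardLike toFun

/-- A forcing together with an enumeration of its break points and slopes.  (A forcing has many
enumerations; any two of them differ by a shift of the index.) -/
structure MarkedPLForcing (k : ℕ) where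
  forcing : PLForcing k
  breaks : ℤ → ℝ
  slopes : ℤ → ℝ
  isPLWith : IsPLWith k forcing.toFun breaks slopes

/-- The coordinates of a marked forcing: the positions of its `k` consecutive break points
`x 0, …, x (k - 1)`, the `k` slopes `w 0, …, w (k - 1)`, and the value of the forcing at `x 0`,
which fixes the additive constant that positions and slopes leave free. -/
def MarkedPLForcing.coords {k : ℕ} (m : MarkedPLForcing k) :
    (Fin k → ℝ) × (Fin k → ℝ) × ℝ :=
  (fun i => m.breaks ((i : ℕ) : ℤ), fun i => m.slopes ((i : ℕ) : ℤ),
    m.forcing.toFun (m.breaks 0))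

/-- Marked forcings carry the topology of their coordinates. -/
instance MarkedPLForcing.instTopologicalSpace (k : ℕ) : TopologicalSpace (MarkedPLForcing k) :=
  TopologicalSpace.induced MarkedPLForcing.coords inferInstance

/-- The topology of break-point positions and slopes on the space of forcings: the quotient of the
topology of coordinates by the choice of the enumeration of the break points. -/
instance PLForcing.instTopologicalSpace (k : ℕ) : TopologicalSpace (PLForcing k) :=
  TopologicalSpace.coinduced MarkedPLForcing.forcing inferInstance

/-- `(b, ω, φ)` is a `p/q`-pinch point: `b > 0` and the `q`-th iterate of the lift is the
translation by `p`.  (For `b > 1` this never happens if `φ` is standard-like.  All lifts are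
covered, since `ω` is any real and `p` any integer.) -/
def IsPinchPoint (p : ℤ) (q : ℕ) (b ω : ℝ) (φ : ℝ → ℝ) : Prop :=
  0 < b ∧ ∀ x : ℝ, (circleFamily b ω φ)^[q] x = x + p

/-- No rational tongue `T_{p/q}` (lowest terms) of the `(ω, b)`-family of `φ` is pinched. -/
def HasNoPinching (φ : ℝ → ℝ) : Prop :=
  ∀ (p : ℤ) (q : ℕ), 0 < q → IsCoprime p (q : ℤ) → ∀ b ω : ℝ, ¬ IsPinchPoint p q b ω φ

/-! At a pinch point an iterate `f^[q]` of a piecewise linear lift is an integer translation, and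
this forces linear relations between the lengths of the intervals of affinity. Along the orbit of a
break point the products of right slopes and of left slopes are both 1, so the jump of the slope
must be compensated at a break point of another class (`exists_iterate_eq_break`). The orbits of the
break points form a locally finite set whose gaps are permuted by `f`, affinely on each. Over a
field `K` containing the slopes of `f`, every gap is thus a multiple of the gap to the right of some
break point, and gaps met by one orbit are proportional. For `k > 2` the lengths therefore span at
most `k - 2` dimensions over `K` (`exists_finset_forall_mem_span`).

The slopes of `f` are `1 + b * w i`, and `b` solves one of countably many nontrivial polynomial
equations, so one countable `K` serves all pinch points of all forcings with slopes `w`. Periodicity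
imposes the single relation `∑ w i * ℓ i = 0`. By Baire, the vectors of this hyperplane whose
coordinates satisfy no other relation over `K` are dense, and their coordinates span `k - 1`
dimensions. Moving break points with fixed slopes keeps a forcing standard-like, since this only
says that the least slope is `-1`; density follows.

For the `Gδ` property, pinching with `(b, ω)` in a compact box is a closed condition, and countably
many boxes exhaust `b > 0`. -/

/-! ### Quasi-periodic sequences -/

theorem apply_add_zsmul_period {k : ℕ} {S : ℝ} {g : ℤ → ℝ} (hg : ∀ i, g (i + k) = g i + S)
    (i n : ℤ) : g (i + n * k) = g i + n * S := by
  induction n using Int.induction_on with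
  | zero => simp
  | succ n ih =>
    rw [show i + ((n : ℤ) + 1) * k = i + n * k + k by ring, hg, ih]; push_cast; ring
  | pred n ih =>
    have := hg (i + (-(n : ℤ) - 1) * k)
    rw [show i + (-(n : ℤ) - 1) * k + k = i + -(n : ℤ) * k by ring, ih] at this
    push_cast at this ⊢; linarith

theorem exists_apply_le_of_add_period {k : ℕ} {g : ℤ → ℝ} (hg : ∀ i, g (i + k) = g i + 1) (t : ℝ) :
    ∃ i, g i ≤ t := by
  refine ⟨0 + ⌊t - g 0⌋ * k, ?_⟩
  rw [apply_add_zsmul_period hg]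
  linarith [Int.floor_le (t - g 0)]

theorem exists_lt_apply_of_add_period {k : ℕ} {g : ℤ → ℝ} (hg : ∀ i, g (i + k) = g i + 1) (t : ℝ) :
    ∃ i, t < g i := by
  refine ⟨0 + (⌊t - g 0⌋ + 1) * k, ?_⟩
  rw [apply_add_zsmul_period hg]
  push_cast
  linarith [Int.lt_floor_add_one (t - g 0)]

theorem StrictMono.exists_mem_Ico_of_add_period {k : ℕ} {g : ℤ → ℝ} (hmono : StrictMono g)
    (hg : ∀ i, g (i + k) = g i + 1) (t : ℝ) : ∃ i, t ∈ Set.Ico (g i) (g (i + 1)) := by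
  obtain ⟨j, hj⟩ := exists_lt_apply_of_add_period hg t
  obtain ⟨i, hi, hmax⟩ := Int.exists_greatest_of_bdd (P := fun i => g i ≤ t)
    ⟨j, fun z hz => (hmono.lt_iff_lt.1 (lt_of_le_of_lt hz hj)).le⟩
    (exists_apply_le_of_add_period hg t)
  refine ⟨i, hi, ?_⟩
  by_contra! h
  have := hmax _ h
  omega

theorem StrictMono.eq_of_mem_Ico {g : ℤ → ℝ} (hmono : StrictMono g) {t : ℝ} {i j : ℤ}
    (hi : t ∈ Set.Ico (g i) (g (i + 1))) (hj : t ∈ Set.Ico (g j) (g (j + 1))) : i = j := by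
  have h1 := hmono.lt_iff_lt.1 (lt_of_le_of_lt hi.1 hj.2)
  have h2 := hmono.lt_iff_lt.1 (lt_of_le_of_lt hj.1 hi.2)
  omega

theorem StrictMono.finite_range_inter_Icc {k : ℕ} {g : ℤ → ℝ} (hmono : StrictMono g)
    (hg : ∀ i, g (i + k) = g i + 1) (a b : ℝ) : (Set.range g ∩ Set.Icc a b).Finite := by
  obtain ⟨i, hi⟩ := exists_apply_le_of_add_period hg a
  obtain ⟨j, hj⟩ := exists_lt_apply_of_add_period hg b
  refine ((Set.finite_Icc i j).image g).subset ?_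
  rintro _ ⟨⟨n, rfl⟩, hn⟩
  exact ⟨n, ⟨hmono.le_iff_le.1 (hi.trans hn.1), (hmono.lt_iff_lt.1 (hn.2.trans_lt hj)).le⟩, rfl⟩

/-! ### Piecewise linear forcings -/

/-- The increase of a piecewise linear function along an interval `[a, b]` of slope one. -/
def ramp (a b t : ℝ) : ℝ := max 0 (min (t - a) (b - a))

theorem ramp_of_le_left {a b t : ℝ} (h : t ≤ a) : ramp a b t = 0 :=
  max_eq_left ((min_le_left _ _).trans (sub_nonpos.2 h))

theorem ramp_of_mem {a b t : ℝ} (h1 : a ≤ t) (h2 : t ≤ b) : ramp a b t = t - a := by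
  rw [ramp, min_eq_left (by linarith), max_eq_right (by linarith)]

theorem ramp_of_right_le {a b t : ℝ} (hab : a ≤ b) (h : b ≤ t) : ramp a b t = b - a := by
  rw [ramp, min_eq_right (by linarith), max_eq_right (by linarith)]

namespace IsPLWith

variable {k : ℕ} {φ : ℝ → ℝ} {x w : ℤ → ℝ}

theorem apply_succ (h : IsPLWith k φ x w) (i : ℤ) :
    φ (x (i + 1)) = φ (x i) + w i * (x (i + 1) - x i) :=
  h.affine i _ ⟨(h.strictMono (lt_add_one i)).le, le_rfl⟩

theorem period_pos (h : IsPLWith k φ x w) : 0 < k := by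
  rcases Nat.eq_zero_or_pos k with rfl | hk
  · have := h.break_add 0
    simp at this
  · exact hk

/-- A formula free of case distinctions, from which continuity in the break points and slopes can be
read off. -/
theorem eq_sum_ramp (h : IsPLWith k φ x w) (n : ℕ) {t : ℝ} (ht : t ∈ Set.Icc (x 0) (x n)) :
    φ t = φ (x 0) + ∑ i ∈ Finset.range n, w i * ramp (x i) (x (i + 1)) t := by
  induction n generalizing t with
  | zero => simp [le_antisymm ht.2 ht.1]
  | succ n ih =>
    push_cast at ht
    rw [Finset.sum_range_succ]
    rcases le_total t (x n) with htn | htn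
    · rw [ih ⟨ht.1, htn⟩, ramp_of_le_left htn]; ring
    · rw [h.affine n t ⟨htn, ht.2⟩, ramp_of_mem htn ht.2,
        ih ⟨h.strictMono.monotone (by omega), le_rfl⟩, ← add_assoc]
      congr 2
      refine Finset.sum_congr rfl fun i hi => ?_
      have hi' := Finset.mem_range.1 hi
      have h1 : x i ≤ x (i + 1) := (h.strictMono (lt_add_one _)).le
      have h2 : x (i + 1) ≤ x n := h.strictMono.monotone (by omega)
      rw [ramp_of_right_le h1 h2, ramp_of_right_le h1 (h2.trans htn)]

end IsPLWith

/-! ### Joint continuity in the coordinates of a marked forcing -/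

namespace MarkedPLForcing

variable {k : ℕ}

theorem continuous_coords : Continuous (coords : MarkedPLForcing k → _) :=
  continuous_induced_dom

theorem continuous_breaks {i : ℕ} (hi : i ≤ k) :
    Continuous fun m : MarkedPLForcing k => m.breaks i := by
  have key : ∀ j : Fin k, Continuous fun m : MarkedPLForcing k => m.breaks ((j : ℕ) : ℤ) :=
    fun j => (continuous_apply j).comp (continuous_fst.comp continuous_coords)
  rcases hi.lt_or_eq with hi | rfl
  · exact key ⟨i, hi⟩
  · rcases Nat.eq_zero_or_pos i with rfl | hk
    · have : IsEmpty (MarkedPLForcing 0) := ⟨fun m => m.isPLWith.period_pos.false⟩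
      exact continuous_of_const fun m => this.elim m
    · have : ∀ m : MarkedPLForcing i, m.breaks i = m.breaks ((0 : ℕ) : ℤ) + 1 := fun m => by
        simpa using m.isPLWith.break_add 0
      simp only [this]
      exact (key ⟨0, hk⟩).add continuous_const

theorem continuous_slopes {i : ℕ} (hi : i < k) :
    Continuous fun m : MarkedPLForcing k => m.slopes i :=
  (continuous_apply (⟨i, hi⟩ : Fin k)).comp
    (continuous_fst.comp (continuous_snd.comp continuous_coords))

theorem continuous_apply_break_zero :
    Continuous fun m : MarkedPLForcing k => m.forcing.toFun (m.breaks 0) :=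
  continuous_snd.comp (continuous_snd.comp continuous_coords)

/-- The ramp formula gives continuity on the period starting at `x 0`; the values at its two ends
agree, so composing with the fractional part extends it to the line. -/
theorem continuous_eval :
    Continuous fun z : MarkedPLForcing k × ℝ => z.1.forcing.toFun z.2 := by
  set G : MarkedPLForcing k → ℝ → ℝ := fun m u => m.forcing.toFun (m.breaks 0 + u) with hG
  have hx0 : Continuous fun m : MarkedPLForcing k => m.breaks 0 :=
    continuous_breaks (Nat.zero_le k)
  have hcont : ContinuousOn (Function.uncurry G) (Set.univ ×ˢ Set.Icc 0 1) := by
    have hF : Continuous fun z : MarkedPLForcing k × ℝ => z.1.forcing.toFun (z.1.breaks 0) +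
        ∑ i ∈ Finset.range k, z.1.slopes i *
          ramp (z.1.breaks i) (z.1.breaks (i + 1)) (z.1.breaks 0 + z.2) := by
      refine (continuous_apply_break_zero.comp continuous_fst).add
        (continuous_finsetSum _ fun i hi => ?_)
      have hi := Finset.mem_range.1 hi
      have h1 := (continuous_slopes hi).comp (continuous_fst (Y := ℝ))
      have h2 := (continuous_breaks hi.le).comp (continuous_fst (Y := ℝ))
      have h3 := (continuous_breaks (i := i + 1) hi).comp (continuous_fst (Y := ℝ))
      have h4 := hx0.comp (continuous_fst (Y := ℝ))
      push_cast at h3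
      simp only [Function.comp_def] at h1 h2 h3 h4
      unfold ramp
      fun_prop
    refine hF.continuousOn.congr ?_
    rintro ⟨m, u⟩ ⟨-, hu⟩
    refine m.isPLWith.eq_sum_ramp k ⟨by linarith [hu.1], ?_⟩
    have := m.isPLWith.break_add 0
    rw [zero_add] at this
    rw [this]
    linarith [hu.2]
  have hfr := ContinuousOn.comp_fract' hcont fun m => by
    simpa [hG] using (m.forcing.periodic (m.breaks 0)).symm
  have heq : (fun z : MarkedPLForcing k × ℝ => z.1.forcing.toFun z.2) =
      (fun z : MarkedPLForcing k × ℝ => G z.1 (Int.fract z.2)) ∘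
        fun z => (z.1, z.2 - z.1.breaks 0) := by
    funext z
    simp only [hG, Function.comp]
    have := (z.1.forcing.periodic.int_mul (⌊z.2 - z.1.breaks 0⌋))
      (z.1.breaks 0 + Int.fract (z.2 - z.1.breaks 0))
    rw [← this]
    congr 1
    rw [Int.fract]; ring
  rw [heq]
  exact hfr.comp (continuous_fst.prodMk (continuous_snd.sub (hx0.comp continuous_fst)))

theorem continuous_toFun (m : MarkedPLForcing k) : Continuous m.forcing.toFun :=
  continuous_eval.comp (continuous_const.prodMk continuous_id)

theorem continuous_iterate_circleFamily (q : ℕ) :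
    Continuous fun z : (MarkedPLForcing k × ℝ × ℝ) × ℝ =>
      (circleFamily z.1.2.1 z.1.2.2 z.1.1.forcing.toFun)^[q] z.2 := by
  induction q with
  | zero => exact continuous_snd
  | succ q ih =>
    simp only [Function.iterate_succ_apply']
    conv => enter [1, z]; rw [circleFamily]
    have h1 : Continuous fun z : (MarkedPLForcing k × ℝ × ℝ) × ℝ => z.1.1.forcing.toFun
        ((circleFamily z.1.2.1 z.1.2.2 z.1.1.forcing.toFun)^[q] z.2) :=
      continuous_eval.comp ((continuous_fst.comp continuous_fst).prodMk ih)
    fun_prop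

theorem forcing_surjective :
    Function.Surjective (forcing : MarkedPLForcing k → PLForcing k) := fun φ => by
  obtain ⟨x, w, h⟩ := φ.exists_isPLWith
  exact ⟨⟨φ, x, w, h⟩, rfl⟩

theorem continuous_forcing : Continuous (forcing : MarkedPLForcing k → PLForcing k) :=
  continuous_coinduced_rng

end MarkedPLForcing

/-! ### The set of forcings without pinching is a `Gδ` -/

namespace PLForcing

variable {k : ℕ}

/-- In the quotient topology closedness is tested on marked forcings, where the set is the
projection of a closed set along a compact factor. The bound `ε` keeps away from `b = 0`, where
rotation by `p / q` solves the equation for every forcing. -/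
theorem isClosed_setOf_exists_isPinchPoint (p : ℤ) (q : ℕ) {ε R : ℝ} (hε : 0 < ε) :
    IsClosed {φ : PLForcing k | ∃ b ∈ Set.Icc ε R, ∃ ω ∈ Set.Icc (-R) R,
      IsPinchPoint p q b ω φ.toFun} := by
  refine (isClosed_coinduced (f := (MarkedPLForcing.forcing : MarkedPLForcing k → _))).2 ?_
  let C : Set (MarkedPLForcing k × (Set.Icc ε R ×ˢ Set.Icc (-R) R : Set (ℝ × ℝ))) :=
    {z | ∀ t : ℝ, (circleFamily z.2.1.1 z.2.1.2 z.1.forcing.toFun)^[q] t = t + p}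
  have hC : IsClosed C := by
    simp only [C, Set.ofPred_forall]
    refine isClosed_iInter fun t => isClosed_eq ?_ continuous_const
    exact (MarkedPLForcing.continuous_iterate_circleFamily q).comp
      (f := fun z : MarkedPLForcing k × (Set.Icc ε R ×ˢ Set.Icc (-R) R : Set (ℝ × ℝ)) =>
        ((z.1, z.2.1.1, z.2.1.2), t)) (by fun_prop)
  have : CompactSpace (Set.Icc ε R ×ˢ Set.Icc (-R) R : Set (ℝ × ℝ)) :=
    isCompact_iff_compactSpace.1 (isCompact_Icc.prod isCompact_Icc)
  convert isClosedMap_fst_of_compactSpace C hC using 1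
  ext m
  constructor
  · rintro ⟨b, hb, ω, hω, -, h⟩
    exact ⟨(m, ⟨(b, ω), hb, hω⟩), h, rfl⟩
  · rintro ⟨⟨m, ⟨⟨b, ω⟩, hb, hω⟩⟩, h, rfl⟩
    exact ⟨b, hb, ω, hω, hε.trans_le hb.1, h⟩

theorem isGδ_setOf_hasNoPinching : IsGδ {φ : PLForcing k | HasNoPinching φ.toFun} := by
  have heq : {φ : PLForcing k | HasNoPinching φ.toFun} =
      ⋂ z : {z : ℤ × ℕ × ℕ // 0 < z.2.1 ∧ IsCoprime z.1 (z.2.1 : ℤ)},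
        {φ : PLForcing k | ∃ b ∈ Set.Icc (1 / ((z.1.2.2 : ℝ) + 1)) z.1.2.2,
          ∃ ω ∈ Set.Icc (-(z.1.2.2 : ℝ)) z.1.2.2,
            IsPinchPoint z.1.1 z.1.2.1 b ω φ.toFun}ᶜ := by
    ext φ
    simp only [Set.mem_ofPred_eq, Set.mem_iInter, Set.mem_compl_iff, not_exists, not_and]
    constructor
    · rintro h ⟨⟨p, q, n⟩, hq, hpq⟩ b - ω -
      exact h p q hq hpq b ω
    · intro h p q hq hpq b ω hpin
      obtain ⟨n₁, h₁⟩ := exists_nat_one_div_lt hpin.1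
      obtain ⟨n₂, h₂⟩ := exists_nat_ge b
      obtain ⟨n₃, h₃⟩ := exists_nat_ge |ω|
      set n := max n₁ (max n₂ n₃)
      have hn₁ : (n₁ : ℝ) ≤ n := by exact_mod_cast le_max_left _ _
      have hn₂ : (n₂ : ℝ) ≤ n := by exact_mod_cast (le_max_left _ _).trans (le_max_right _ _)
      have hn₃ : (n₃ : ℝ) ≤ n := by exact_mod_cast (le_max_right _ _).trans (le_max_right _ _)
      refine h ⟨⟨p, q, n⟩, hq, hpq⟩ b ⟨?_, h₂.trans hn₂⟩ ω (abs_le.1 (h₃.trans hn₃)) hpin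
      exact le_trans (one_div_le_one_div_of_le (by positivity) (by linarith)) h₁.le
  rw [heq]
  exact IsGδ.iInter_of_isOpen fun z =>
    (isClosed_setOf_exists_isPinchPoint _ _ (by positivity)).isOpen_compl

end PLForcing

/-! ### Consecutive points of locally finite sets of reals -/

/-- `y < z` are points of `D` with no point of `D` strictly in between. -/
structure AreConsecutive (D : Set ℝ) (y z : ℝ) : Prop where
  left_mem : y ∈ D
  right_mem : z ∈ D
  lt : y < z
  right_le : ∀ u ∈ D, y < u → z ≤ u

theorem AreConsecutive.unique {D : Set ℝ} {y z z' : ℝ} (h : AreConsecutive D y z)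
    (h' : AreConsecutive D y z') : z = z' :=
  le_antisymm (h.right_le _ h'.right_mem h'.lt) (h'.right_le _ h.right_mem h.lt)

theorem exists_areConsecutive {D : Set ℝ} (hfin : ∀ a b, (D ∩ Set.Icc a b).Finite) {y u : ℝ}
    (hy : y ∈ D) (hu : u ∈ D) (hyu : y < u) : ∃ z, AreConsecutive D y z := by
  have hfin' : (D ∩ Set.Ioc y u).Finite :=
    (hfin y u).subset (Set.inter_subset_inter_right _ Set.Ioc_subset_Icc_self)
  obtain ⟨z, ⟨hzD, hz⟩, hmin⟩ := hfin'.exists_minimal ⟨u, hu, hyu, le_rfl⟩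
  refine ⟨z, hy, hzD, hz.1, fun v hv hyv => ?_⟩
  rcases le_total v u with hvu | hvu
  · rcases le_total z v with h | h
    · exact h
    · exact hmin ⟨hv, hyv, hvu⟩ h
  · exact hz.2.trans hvu

/-- The distance telescopes into finitely many gaps. -/
theorem sub_mem_of_areConsecutive {D : Set ℝ} (hfin : ∀ a b, (D ∩ Set.Icc a b).Finite)
    {S : Type*} [SetLike S ℝ] [AddSubmonoidClass S ℝ] (W : S)
    (hW : ∀ y z, AreConsecutive D y z → z - y ∈ W) {y z : ℝ} (hy : y ∈ D) (hz : z ∈ D)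
    (hyz : y < z) : z - y ∈ W := by
  induction hn : (D ∩ Set.Icc y z).ncard using Nat.strong_induction_on generalizing y with
  | _ n ih =>
    obtain ⟨u, hu⟩ := exists_areConsecutive hfin hy hz hyz
    rcases (hu.right_le z hz hyz).eq_or_lt with rfl | huz
    · exact hW _ _ hu
    · have hlt : (D ∩ Set.Icc u z).ncard < n := by
        rw [← hn]
        refine Set.ncard_lt_ncard ⟨Set.inter_subset_inter_right _
          (Set.Icc_subset_Icc_left hu.lt.le), fun hsub => ?_⟩ (hfin _ _)
        exact hu.lt.not_ge (hsub ⟨hy, le_rfl, hyz.le⟩).2.1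
      have := add_mem (ih _ hlt hu.right_mem huz rfl) (hW _ _ hu)
      rwa [sub_add_sub_cancel] at this

/-! ### One-sided derivatives of iterates -/

/-- Chain rule for one-sided derivatives: `A y` will be `Ici y` or `Iic y`, and a monotone map
preserves sides. -/
theorem hasDerivWithinAt_iterate {f s : ℝ → ℝ} {A : ℝ → Set ℝ}
    (hA : ∀ y, Set.MapsTo f (A y) (A (f y))) (hf : ∀ y, HasDerivWithinAt f (s y) (A y) y)
    (n : ℕ) (y : ℝ) :
    HasDerivWithinAt f^[n] (∏ j ∈ Finset.range n, s (f^[j] y)) (A y) y := by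
  induction n generalizing y with
  | zero => simpa using hasDerivWithinAt_id y (A y)
  | succ n ih =>
    rw [Function.iterate_succ, Finset.prod_range_succ']
    exact (ih (f y)).comp y (hf y) (hA y)

/-! ### Piecewise linear lifts of circle homeomorphisms -/

/-- `f` is the lift of a piecewise linear circle homeomorphism of degree one with `k` break
points, which lift to the sequence `x`, and slope `s i` on `[x i, x (i + 1)]`. -/
structure IsPLLift (k : ℕ) (f : ℝ → ℝ) (x s : ℤ → ℝ) : Prop where
  strictMono : StrictMono f
  map_add_one : ∀ t, f (t + 1) = f t + 1
  breaks_strictMono : StrictMono x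
  break_add : ∀ i : ℤ, x (i + k) = x i + 1
  slope_add : ∀ i : ℤ, s (i + k) = s i
  slope_ne : ∀ i : ℤ, s (i + 1) ≠ s i
  affine : ∀ i : ℤ, ∀ t ∈ Set.Icc (x i) (x (i + 1)), f t = f (x i) + s i * (t - x i)

/-- The union of the forward orbits of the points of the sequence `x`. -/
def orbitSet (f : ℝ → ℝ) (x : ℤ → ℝ) : Set ℝ := {y | ∃ n : ℕ, ∃ i : ℤ, f^[n] (x i) = y}

theorem break_mem_orbitSet (f : ℝ → ℝ) (x : ℤ → ℝ) (i : ℤ) : x i ∈ orbitSet f x := ⟨0, i, rfl⟩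

namespace IsPLLift

variable {k : ℕ} {f : ℝ → ℝ} {x s : ℤ → ℝ} (h : IsPLLift k f x s)
include h

theorem slope_pos (i : ℤ) : 0 < s i := by
  have hx : x i < x (i + 1) := h.breaks_strictMono (lt_add_one i)
  have h1 := h.affine i _ ⟨hx.le, le_rfl⟩
  have h2 := h.strictMono hx
  have h3 : 0 < s i * (x (i + 1) - x i) := by linarith
  exact (pos_iff_pos_of_mul_pos h3).2 (sub_pos.2 hx)

theorem slope_add_mul (i n : ℤ) : s (i + n * k) = s i := by
  simpa using apply_add_zsmul_period (S := 0) (fun i => by simpa using h.slope_add i) i n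

theorem slope_eq_of_dvd {i j : ℤ} (hij : (k : ℤ) ∣ j - i) : s j = s i := by
  obtain ⟨n, hn⟩ := hij
  rw [← h.slope_add_mul i n, show i + n * k = j by linarith]

theorem iterate_add_one (n : ℕ) (t : ℝ) : f^[n] (t + 1) = f^[n] t + 1 := by
  induction n generalizing t with
  | zero => rfl
  | succ n ih => rw [Function.iterate_succ_apply, h.map_add_one, ih, Function.iterate_succ_apply]

theorem sub_eq_mul {i : ℤ} {y z : ℝ} (hy : y ∈ Set.Icc (x i) (x (i + 1)))
    (hz : z ∈ Set.Icc (x i) (x (i + 1))) : f z - f y = s i * (z - y) := by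
  rw [h.affine i z hz, h.affine i y hy]; ring

theorem hasDerivWithinAt_Ici {i : ℤ} {y : ℝ} (hy : y ∈ Set.Ico (x i) (x (i + 1))) :
    HasDerivWithinAt f (s i) (Set.Ici y) y := by
  have h1 : HasDerivWithinAt (fun t => f (x i) + s i * (t - x i)) (s i) (Set.Ici y) y := by
    simpa using ((((hasDerivAt_id y).sub_const (x i)).const_mul (s i)).const_add
      (f (x i))).hasDerivWithinAt (s := Set.Ici y)
  refine h1.congr_of_eventuallyEq ?_ (h.affine i y ⟨hy.1, hy.2.le⟩)
  filter_upwards [Ico_mem_nhdsGE hy.2] with t ht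
  exact h.affine i t ⟨hy.1.trans ht.1, ht.2.le⟩

theorem hasDerivWithinAt_Iic {i : ℤ} {y : ℝ} (hy : y ∈ Set.Ioc (x i) (x (i + 1))) :
    HasDerivWithinAt f (s i) (Set.Iic y) y := by
  have h1 : HasDerivWithinAt (fun t => f (x i) + s i * (t - x i)) (s i) (Set.Iic y) y := by
    simpa using ((((hasDerivAt_id y).sub_const (x i)).const_mul (s i)).const_add
      (f (x i))).hasDerivWithinAt (s := Set.Iic y)
  refine h1.congr_of_eventuallyEq ?_ (h.affine i y ⟨hy.1.le, hy.2⟩)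
  filter_upwards [Ioc_mem_nhdsLE hy.1] with t ht
  exact h.affine i t ⟨ht.1.le, ht.2.trans hy.2⟩

theorem exists_mem_Ico (t : ℝ) : ∃ i, t ∈ Set.Ico (x i) (x (i + 1)) :=
  h.breaks_strictMono.exists_mem_Ico_of_add_period h.break_add t

theorem exists_mem_Ioc (t : ℝ) : ∃ i, t ∈ Set.Ioc (x i) (x (i + 1)) := by
  obtain ⟨i, hi⟩ := h.exists_mem_Ico t
  rcases hi.1.eq_or_lt with heq | hlt
  · refine ⟨i - 1, ?_, ?_⟩
    · rw [← heq]; exact h.breaks_strictMono (sub_one_lt i)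
    · rw [sub_add_cancel, heq]
  · exact ⟨i, hlt, hi.2.le⟩

section Periodic

variable {p : ℤ} {q : ℕ} (hpin : ∀ t, f^[q] t = t + p)
include hpin

theorem prod_right_slope_eq_one {r : ℝ → ℤ} (hr : ∀ t, t ∈ Set.Ico (x (r t)) (x (r t + 1)))
    (t : ℝ) : ∏ j ∈ Finset.range q, s (r (f^[j] t)) = 1 := by
  have h1 := hasDerivWithinAt_iterate (A := Set.Ici) (s := fun t => s (r t))
    (fun y z hz => h.strictMono.monotone hz) (fun y => h.hasDerivWithinAt_Ici (hr y)) q t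
  rw [funext hpin] at h1
  exact (uniqueDiffOn_Ici t t Set.self_mem_Ici).eq_deriv _ h1
    ((hasDerivAt_id t).add_const (p : ℝ)).hasDerivWithinAt

theorem prod_left_slope_eq_one {l : ℝ → ℤ} (hl : ∀ t, t ∈ Set.Ioc (x (l t)) (x (l t + 1)))
    (t : ℝ) : ∏ j ∈ Finset.range q, s (l (f^[j] t)) = 1 := by
  have h1 := hasDerivWithinAt_iterate (A := Set.Iic) (s := fun t => s (l t))
    (fun y z hz => h.strictMono.monotone hz) (fun y => h.hasDerivWithinAt_Iic (hl y)) q t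
  rw [funext hpin] at h1
  exact (uniqueDiffOn_Iic t t Set.self_mem_Iic).eq_deriv _ h1
    ((hasDerivAt_id t).add_const (p : ℝ)).hasDerivWithinAt

/-- The jumps of the logarithmic derivative along an orbit cancel, so the orbit of a break point
meets a break point of another class modulo `k`. -/
theorem exists_iterate_eq_break (hq : 0 < q) (i : ℤ) :
    ∃ n : ℕ, ∃ j : ℤ, f^[n] (x i) = x j ∧ ¬ (k : ℤ) ∣ j - i := by
  classical
  by_contra! hcon
  choose r hr using h.exists_mem_Ico
  choose l hl using h.exists_mem_Ioc
  -- The jump factor is 1 off the break points; at a break point it depends only on the class modulo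
  -- `k`, and by `hcon` only the class of `i` is met.
  have hratio : ∀ n : ℕ, s (r (f^[n] (x i))) / s (l (f^[n] (x i))) =
      if f^[n] (x i) ∈ Set.range x then s i / s (i - 1) else 1 := by
    intro n
    split_ifs with hn
    · obtain ⟨j, hj⟩ := hn
      have hdvd := hcon n j hj.symm
      have hrj : r (f^[n] (x i)) = j := by
        refine h.breaks_strictMono.eq_of_mem_Ico (hr _) ?_
        rw [← hj]
        exact ⟨le_rfl, h.breaks_strictMono (lt_add_one j)⟩
      have hlj : l (f^[n] (x i)) = j - 1 := by
        have h1 := hl (f^[n] (x i))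
        rw [← hj] at h1 ⊢
        have h2 := h.breaks_strictMono.lt_iff_lt.1 h1.1
        have h3 := h.breaks_strictMono.le_iff_le.1 h1.2
        omega
      rw [hrj, hlj, h.slope_eq_of_dvd hdvd,
        h.slope_eq_of_dvd (i := i - 1) (j := j - 1) (by simpa using hdvd)]
    · have hrl : r (f^[n] (x i)) = l (f^[n] (x i)) := by
        have h1 := hl (f^[n] (x i))
        refine h.breaks_strictMono.eq_of_mem_Ico (hr _) ⟨h1.1.le, h1.2.lt_of_ne fun heq => hn ?_⟩
        exact ⟨_, heq.symm⟩
      rw [hrl, div_self (h.slope_pos _).ne']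
  have hprod : ∏ n ∈ Finset.range q, s (r (f^[n] (x i))) / s (l (f^[n] (x i))) = 1 := by
    rw [Finset.prod_div_distrib, h.prod_right_slope_eq_one hpin hr,
      h.prod_left_slope_eq_one hpin hl, div_one]
  simp only [hratio] at hprod
  -- The product is a power of `s i / s (i - 1)` whose exponent counts visits to break points; it is
  -- nonzero because time 0 is a visit.
  rw [Finset.prod_ite, Finset.prod_const_one, mul_one, Finset.prod_const,
    pow_eq_one_iff_of_nonneg (div_pos (h.slope_pos _) (h.slope_pos _)).le,
    div_eq_one_iff_eq (h.slope_pos _).ne'] at hprod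
  · exact h.slope_ne (i - 1) (by rwa [sub_add_cancel])
  · rw [Finset.card_ne_zero]
    exact ⟨0, Finset.mem_filter.2 ⟨Finset.mem_range.2 hq, i, rfl⟩⟩

end Periodic

end IsPLLift

/-! ### The gaps of the orbit set of a periodic lift -/

namespace IsPLLift

variable {k : ℕ} {f : ℝ → ℝ} {x s : ℤ → ℝ} (h : IsPLLift k f x s)
include h

omit h in
theorem map_mem_orbitSet {y : ℝ} (hy : y ∈ orbitSet f x) : f y ∈ orbitSet f x := by
  obtain ⟨n, i, rfl⟩ := hy
  exact ⟨n + 1, i, Function.iterate_succ_apply' _ _ _⟩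

theorem iterate_break_add (n : ℕ) (i m : ℤ) : f^[n] (x (i + m * k)) = f^[n] (x i) + m := by
  simpa using apply_add_zsmul_period (g := fun i => f^[n] (x i)) (S := 1)
    (fun i => by rw [h.break_add, h.iterate_add_one]) i m

theorem add_int_mem_orbitSet {y : ℝ} (hy : y ∈ orbitSet f x) (m : ℤ) : y + m ∈ orbitSet f x := by
  obtain ⟨n, i, rfl⟩ := hy
  exact ⟨n, i + m * k, h.iterate_break_add n i m⟩

theorem areConsecutive_add_int {y z : ℝ} (hyz : AreConsecutive (orbitSet f x) y z) (m : ℤ) :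
    AreConsecutive (orbitSet f x) (y + m) (z + m) where
  left_mem := h.add_int_mem_orbitSet hyz.left_mem m
  right_mem := h.add_int_mem_orbitSet hyz.right_mem m
  lt := by linarith [hyz.lt]
  right_le u hu hlt := by
    have h1 := h.add_int_mem_orbitSet hu (-m)
    push_cast at h1
    linarith [hyz.right_le _ h1 (by linarith)]

section Periodic

variable {p : ℤ} {q : ℕ} (hpin : ∀ t, f^[q] t = t + p) (hq : 0 < q)
include hpin hq

/-- Modulo integer translations, which preserve the break points, only the first `q` iterates
matter. -/
theorem finite_orbitSet_inter_Icc (a b : ℝ) : (orbitSet f x ∩ Set.Icc a b).Finite := by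
  have hfin : (⋃ n ∈ Finset.range q, Set.range (fun i => f^[n] (x i)) ∩ Set.Icc a b).Finite :=
    (Finset.range q).finite_toSet.biUnion fun n _ =>
      ((h.strictMono.iterate n).comp h.breaks_strictMono).finite_range_inter_Icc (k := k)
        (fun i => by simp [h.break_add, h.iterate_add_one]) a b
  refine hfin.subset ?_
  rintro y ⟨⟨n, i, rfl⟩, hy⟩
  suffices H : ∀ n i, ∃ m < q, ∃ j, f^[m] (x j) = f^[n] (x i) by
    obtain ⟨m, hm, j, hj⟩ := H n i
    exact Set.mem_biUnion (Finset.mem_coe.2 (Finset.mem_range.2 hm)) ⟨⟨j, hj⟩, hy⟩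
  clear hy i n
  intro n
  induction n using Nat.strong_induction_on with
  | _ n ih =>
    intro i
    rcases lt_or_ge n q with hn | hn
    · exact ⟨n, hn, i, rfl⟩
    · obtain ⟨m, hm, j, hj⟩ := ih (n - q) (by omega) (i + p * k)
      refine ⟨m, hm, j, hj.trans ?_⟩
      rw [h.iterate_break_add, ← hpin, ← Function.iterate_add_apply, Nat.add_sub_cancel' hn]

theorem exists_map_eq_of_mem_orbitSet {y : ℝ} (hy : y ∈ orbitSet f x) :
    ∃ z ∈ orbitSet f x, f z = y := by
  obtain ⟨n, i, rfl⟩ := hy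
  -- The inverse of `f` is `f^[q - 1]` followed by translation by `-p`, realised by shifting the
  -- index by `-p` periods.
  refine ⟨_, ⟨n + (q - 1), i + (-p) * k, rfl⟩, ?_⟩
  rw [← Function.iterate_succ_apply' f, show (n + (q - 1)).succ = q + n by omega,
    Function.iterate_add_apply, hpin, h.iterate_break_add]
  simp

theorem areConsecutive_map {y z : ℝ} (hyz : AreConsecutive (orbitSet f x) y z) :
    AreConsecutive (orbitSet f x) (f y) (f z) where
  left_mem := map_mem_orbitSet hyz.left_mem
  right_mem := map_mem_orbitSet hyz.right_mem
  lt := h.strictMono hyz.lt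
  right_le u hu hlt := by
    obtain ⟨v, hv, rfl⟩ := h.exists_map_eq_of_mem_orbitSet hpin hq hu
    exact h.strictMono.monotone (hyz.right_le v hv (h.strictMono.lt_iff_lt.1 hlt))

/-- No gap contains a break point in its interior, so each application of `f` scales it by a single
slope. -/
theorem areConsecutive_iterate {K : Subfield ℝ} (hK : ∀ i, s i ∈ K) {y z : ℝ}
    (hyz : AreConsecutive (orbitSet f x) y z) (n : ℕ) :
    AreConsecutive (orbitSet f x) (f^[n] y) (f^[n] z) ∧
      ∃ c ∈ K, c ≠ 0 ∧ f^[n] z - f^[n] y = c * (z - y) := by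
  induction n with
  | zero => exact ⟨hyz, 1, one_mem K, one_ne_zero, by simp⟩
  | succ n ih =>
    obtain ⟨hcons, c, hc, hc0, heq⟩ := ih
    simp only [Function.iterate_succ_apply']
    refine ⟨h.areConsecutive_map hpin hq hcons, ?_⟩
    obtain ⟨i, hi⟩ := h.exists_mem_Ico (f^[n] y)
    have hle := hcons.right_le _ (break_mem_orbitSet f x (i + 1)) hi.2
    refine ⟨s i * c, mul_mem (hK i) hc, mul_ne_zero (h.slope_pos i).ne' hc0, ?_⟩
    rw [h.sub_eq_mul ⟨hi.1, hi.2.le⟩ ⟨hi.1.trans hcons.lt.le, hle⟩, heq, mul_assoc]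

/-- If a piecewise linear circle homeomorphism with `k > 2` break points and slopes in `K` is
periodic, then the distances between its break points span at most `k - 2` dimensions over `K`. -/
theorem exists_finset_forall_mem_span (hk : 2 < k) (K : Subfield ℝ) (hK : ∀ i, s i ∈ K) :
    ∃ T : Finset ℝ, T.card ≤ k - 2 ∧
      ∀ i, x (i + 1) - x i ∈ Submodule.span K (T : Set ℝ) := by
  classical
  have hex : ∀ i, ∃ z, AreConsecutive (orbitSet f x) (x i) z := fun i =>
    exists_areConsecutive (h.finite_orbitSet_inter_Icc hpin hq) (break_mem_orbitSet f x i)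
      (break_mem_orbitSet f x (i + 1)) (h.breaks_strictMono (lt_add_one i))
  choose z hz using hex
  set γ : ℤ → ℝ := fun i => z i - x i with hγ
  have hγ_per : ∀ i n : ℤ, γ (i + n * k) = γ i := fun i n => by
    have h1 := h.areConsecutive_add_int (hz i) n
    have h2 := h.iterate_break_add 0 i n
    simp only [Function.iterate_zero, id] at h2
    rw [← h2] at h1
    simp only [hγ, (hz _).unique h1, h2]
    ring
  have hγ_mod : ∀ i : ℤ, γ (i % k) = γ i := fun i => by
    rw [← hγ_per (i % k) (i / k), Int.emod_add_ediv_mul]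
  have hγ_dvd : ∀ i j : ℤ, (k : ℤ) ∣ j - i → γ j = γ i := fun i j ⟨n, hn⟩ => by
    rw [← hγ_per i n, show i + n * k = j by linarith]
  have hγ_class : ∀ i : ℤ, ∃ j : ℤ, ¬ (k : ℤ) ∣ j - i ∧ ∃ c ∈ K, γ i = c * γ j := fun i => by
    obtain ⟨n, j, hnj, hdvd⟩ := h.exists_iterate_eq_break hpin hq i
    obtain ⟨hcons, c, hc, hc0, heq⟩ := h.areConsecutive_iterate hpin hq hK (hz i) n
    rw [hnj] at hcons heq
    refine ⟨j, hdvd, c⁻¹, inv_mem hc, ?_⟩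
    simp only [hγ, (hz j).unique hcons, heq, inv_mul_cancel_left₀ hc0]
  obtain ⟨j, hj, c, hc, hcj⟩ := hγ_class 0
  -- A class `l` other than those of `0` and `j` exists as `k > 2`. Both `γ 0` and `γ l` are then
  -- redundant: `γ 0` is a multiple of the retained `γ j`, and `γ l` is a multiple of a retained gap
  -- or of `γ 0`.
  obtain ⟨l, hl0, hlk, hlj⟩ : ∃ l : ℤ, 0 < l ∧ l < k ∧ ¬ (k : ℤ) ∣ j - l := by
    by_cases h1 : (k : ℤ) ∣ j - 1
    · refine ⟨2, by omega, by omega, fun h2 => ?_⟩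
      have := Int.le_of_dvd one_pos (by simpa using dvd_sub h1 h2)
      omega
    · exact ⟨1, by omega, by omega, h1⟩
  set I : Finset ℤ := ((Finset.Ico (0 : ℤ) k).erase 0).erase l with hI
  have hIcard : I.card = k - 2 := by
    rw [hI, Finset.card_erase_of_mem (by simp; omega), Finset.card_erase_of_mem (by simp; omega)]
    simp
    omega
  refine ⟨I.image γ, Finset.card_image_le.trans hIcard.le, ?_⟩
  set W := Submodule.span K ((I.image γ : Finset ℝ) : Set ℝ) with hW
  have hmem : ∀ i : ℤ, ¬ (k : ℤ) ∣ i - 0 → ¬ (k : ℤ) ∣ i - l → γ i ∈ W := fun i hi0 hil => by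
    rw [← hγ_mod]
    refine Submodule.subset_span (Finset.mem_coe.2 (Finset.mem_image_of_mem γ ?_))
    have hk0 : (k : ℤ) ≠ 0 := by omega
    rw [hI, Finset.mem_erase, Finset.mem_erase, Finset.mem_Ico]
    refine ⟨fun heq => hil ?_, fun heq => hi0 ?_, Int.emod_nonneg i hk0,
      Int.emod_lt_of_pos i (by omega)⟩
    · rw [← heq]; exact Int.dvd_self_sub_emod
    · rw [sub_zero]; exact Int.dvd_of_emod_eq_zero heq
  have hmem0 : γ 0 ∈ W := by
    rw [hcj]
    exact W.smul_mem (⟨c, hc⟩ : K) (hmem j hj hlj)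
  have hmeml : γ l ∈ W := by
    obtain ⟨j', hj', c', hc', hcj'⟩ := hγ_class l
    rw [hcj']
    refine W.smul_mem (⟨c', hc'⟩ : K) ?_
    by_cases h0 : (k : ℤ) ∣ j' - 0
    · rw [hγ_dvd 0 j' h0]; exact hmem0
    · exact hmem j' h0 hj'
  have hall : ∀ i, γ i ∈ W := fun i => by
    by_cases h0 : (k : ℤ) ∣ i - 0
    · rw [hγ_dvd 0 i h0]; exact hmem0
    · by_cases h1 : (k : ℤ) ∣ i - l
      · rw [hγ_dvd l i h1]; exact hmeml
      · exact hmem i h0 h1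
  refine fun i => sub_mem_of_areConsecutive (h.finite_orbitSet_inter_Icc hpin hq) W ?_
    (break_mem_orbitSet f x i) (break_mem_orbitSet f x (i + 1))
    (h.breaks_strictMono (lt_add_one i))
  rintro y u hyu
  obtain ⟨n, i, rfl⟩ := hyu.left_mem
  obtain ⟨hcons, c, hc, -, heq⟩ := h.areConsecutive_iterate hpin hq hK (hz i) n
  rw [hyu.unique hcons, heq]
  exact W.smul_mem (⟨c, hc⟩ : K) (hall i)

end Periodic

end IsPLLift

/-! ### Generic lengths exclude pinching -/

/-- `K` contains the slopes `w` and all couplings `b` at which some product of slopes of the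
`b`-family is trivial. -/
structure ContainsCouplings (K : Subfield ℝ) (w : ℤ → ℝ) : Prop where
  slope_mem : ∀ i, w i ∈ K
  coupling_mem : ∀ (l : List ℤ) (b : ℝ), (∃ i ∈ l, w i ≠ 0) →
    (l.map fun i => 1 + b * w i).prod = 1 → b ∈ K

/-- The only linear relation over `K` between the lengths `ℓ` is the one with coefficients `w`,
up to multiples. -/
def IsGenericLengths (k : ℕ) (K : Subfield ℝ) (w ℓ : ℤ → ℝ) : Prop :=
  ∀ c : Fin k → K, ∑ i, (c i : ℝ) * ℓ (i : ℕ) = 0 → ∃ r : ℝ, ∀ i, (c i : ℝ) = r * w (i : ℕ)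

/-- Rank-nullity: the relations form at most a line, so the lengths span at least `k - 1`
dimensions. -/
theorem IsGenericLengths.not_forall_mem_span {k : ℕ} (hk : 2 < k) {K : Subfield ℝ} {w ℓ : ℤ → ℝ}
    (hw : ∀ i, w i ∈ K) (hgen : IsGenericLengths k K w ℓ) (hw0 : ∃ i : Fin k, w (i : ℕ) ≠ 0)
    {T : Finset ℝ} (hT : T.card ≤ k - 2) : ¬ ∀ i, ℓ i ∈ Submodule.span K (T : Set ℝ) := by
  intro hmem
  let Φ : (Fin k → K) →ₗ[K] ℝ := Fintype.linearCombination K fun i : Fin k => ℓ (i : ℕ)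
  have hrange : Module.finrank K (LinearMap.range Φ) ≤ k - 2 := by
    refine le_trans (Submodule.finrank_mono (t := Submodule.span K (T : Set ℝ)) ?_)
      ((finrank_span_finset_le_card T).trans hT)
    rw [Fintype.range_linearCombination, Submodule.span_le]
    rintro _ ⟨i, rfl⟩
    exact hmem _
  have hker : Module.finrank K (LinearMap.ker Φ) ≤ 1 := by
    refine le_trans (Submodule.finrank_mono
      (t := Submodule.span K {fun i : Fin k => (⟨w (i : ℕ), hw _⟩ : K)}) ?_)
      ((finrank_span_le_card _).trans (by simp))
    intro c hc
    obtain ⟨r, hr⟩ := hgen c (by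
      rw [LinearMap.mem_ker, Fintype.linearCombination_apply] at hc
      simpa [Subfield.smul_def] using hc)
    obtain ⟨j, hj⟩ := hw0
    -- The factor `r` is only known to be real; a nonzero slope exhibits it as a quotient in `K`.
    refine Submodule.mem_span_singleton.2 ⟨c j / ⟨w (j : ℕ), hw _⟩, ?_⟩
    funext i
    apply Subtype.ext
    simp [hr, hj]
  have := LinearMap.finrank_range_add_finrank_ker Φ
  rw [Module.finrank_fin_fun] at this
  omega

theorem IsPLWith.circleFamily_isPLLift {k : ℕ} {φ : ℝ → ℝ} {x w : ℤ → ℝ} (h : IsPLWith k φ x w)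
    (hper : Function.Periodic φ 1) {b ω : ℝ} (hb : 0 < b)
    (hmono : StrictMono (circleFamily b ω φ)) :
    IsPLLift k (circleFamily b ω φ) x fun i => 1 + b * w i where
  strictMono := hmono
  map_add_one t := by simp only [circleFamily, hper t]; ring
  breaks_strictMono := h.strictMono
  break_add := h.break_add
  slope_add i := by rw [h.slope_add]
  slope_ne i := by simpa [hb.ne'] using h.slope_ne i
  affine i t ht := by simp only [circleFamily, h.affine i t ht]; ring

theorem strictMono_circleFamily_of_injective {φ : ℝ → ℝ} (hφ : Continuous φ)
    (hper : Function.Periodic φ 1) {b ω : ℝ} (hinj : Function.Injective (circleFamily b ω φ)) :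
    StrictMono (circleFamily b ω φ) := by
  have hcont : Continuous (circleFamily b ω φ) := by unfold circleFamily; fun_prop
  refine (hcont.strictMono_of_inj hinj).resolve_right fun hanti => ?_
  have h1 := hanti (zero_lt_one' ℝ)
  have h2 := hper 0
  rw [zero_add] at h2
  simp only [circleFamily, h2] at h1
  linarith

theorem MarkedPLForcing.hasNoPinching_of_isGenericLengths {k : ℕ} (hk : 2 < k)
    (m : MarkedPLForcing k) {K : Subfield ℝ} (hK : ContainsCouplings K m.slopes)
    (hgen : IsGenericLengths k K m.slopes fun i => m.breaks (i + 1) - m.breaks i) :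
    HasNoPinching m.forcing.toFun := by
  rintro p q hq - b ω ⟨hb, hpin⟩
  -- Pinching itself gives injectivity, whatever the size of `b`.
  have hinj : Function.Injective (circleFamily b ω m.forcing.toFun) := by
    refine Function.Injective.of_comp (f := (circleFamily b ω m.forcing.toFun)^[q - 1]) ?_
    rw [← Function.iterate_succ, show (q - 1).succ = q by omega, funext hpin]
    exact add_left_injective _
  have hL := m.isPLWith.circleFamily_isPLLift m.forcing.periodic hb
    (strictMono_circleFamily_of_injective m.continuous_toFun m.forcing.periodic hinj)
  obtain ⟨i₀, hi₀⟩ : ∃ i : Fin k, m.slopes (i : ℕ) ≠ 0 := by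
    by_contra! hcon
    have h0 := hcon ⟨0, by omega⟩
    have h1 := hcon ⟨1, by omega⟩
    apply m.isPLWith.slope_ne 0
    simpa using h1.trans h0.symm
  choose r hr using hL.exists_mem_Ico
  -- Starting the orbit at a break point with nonzero right slope makes the equation for `b`
  -- nontrivial.
  have hbK : b ∈ K := by
    refine hK.coupling_mem
      ((List.range q).map fun j => r ((circleFamily b ω m.forcing.toFun)^[j] (m.breaks (i₀ : ℕ))))
      b ⟨(i₀ : ℕ), List.mem_map.2 ⟨0, List.mem_range.2 hq, ?_⟩, hi₀⟩ ?_
    · exact hL.breaks_strictMono.eq_of_mem_Ico (hr _)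
        ⟨le_rfl, hL.breaks_strictMono (lt_add_one _)⟩
    · rw [List.map_map]
      exact hL.prod_right_slope_eq_one hpin hr _
  obtain ⟨T, hT, hmem⟩ := hL.exists_finset_forall_mem_span hpin hq hk K fun i =>
    add_mem (one_mem K) (mul_mem hbK (hK.slope_mem i))
  exact hgen.not_forall_mem_span hk hK.slope_mem ⟨i₀, hi₀⟩ hT hmem

/-! ### Countable fields containing all couplings -/

open Polynomial in
theorem finite_setOf_prod_one_add_mul_eq_one {w : ℤ → ℝ} {l : List ℤ} (hl : ∃ i ∈ l, w i ≠ 0) :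
    {b : ℝ | (l.map fun i => 1 + b * w i).prod = 1}.Finite := by
  let P : ℝ[X] := (l.map fun i => 1 + X * C (w i)).prod - 1
  have hP : P ≠ 0 := by
    intro h0
    obtain ⟨i, hi, hwi⟩ := hl
    -- If the product were the constant 1, this factor of degree one would be a unit.
    have hdvd : (1 + X * C (w i) : ℝ[X]) ∣ 1 :=
      (List.dvd_prod (List.mem_map_of_mem (f := fun i => 1 + X * C (w i)) hi)).trans
        (sub_eq_zero.1 h0).dvd
    have hdeg := natDegree_eq_zero_of_isUnit (isUnit_of_dvd_one hdvd)
    have := coeff_eq_zero_of_natDegree_lt (p := (1 + X * C (w i) : ℝ[X])) (n := 1) (by omega)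
    rw [coeff_add, coeff_X_mul, coeff_C_zero, coeff_one] at this
    simp at this
    exact hwi this
  refine (finite_setOfPred_isRoot hP).subset fun b hb => ?_
  simp only [Set.mem_ofPred_eq, P, IsRoot.def, eval_sub, eval_one, eval_list_prod,
    List.map_map] at hb ⊢
  rw [sub_eq_zero, ← hb]
  congr 1
  refine List.map_congr_left fun i _ => ?_
  simp only [Function.comp, eval_add, eval_one, eval_mul, eval_X, eval_C]

theorem exists_countable_containsCouplings (w : ℤ → ℝ) :
    ∃ K : Subfield ℝ, Countable K ∧ ContainsCouplings K w := by
  set S : Set ℝ := Set.range w ∪ ⋃ l : {l : List ℤ // ∃ i ∈ l, w i ≠ 0},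
    {b : ℝ | (l.1.map fun i => 1 + b * w i).prod = 1} with hS
  have hSc : S.Countable := (Set.countable_range w).union
    (Set.countable_iUnion fun l => (finite_setOf_prod_one_add_mul_eq_one l.2).countable)
  refine ⟨Subfield.closure S, ?_, ?_, ?_⟩
  · rw [← Cardinal.mk_le_aleph0_iff]
    refine (Subfield.cardinalMk_closure_le_max S).trans (max_le ?_ le_rfl)
    exact Cardinal.mk_le_aleph0_iff.2 hSc.to_subtype
  · exact fun i => Subfield.subset_closure (Or.inl ⟨i, rfl⟩)
  · exact fun l b hl hb => Subfield.subset_closure (Or.inr (Set.mem_iUnion.2 ⟨⟨l, hl⟩, hb⟩))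

/-! ### Generic vectors in a hyperplane -/

/-- Each `c` not proportional to `w` vanishes on a proper, hence closed and nowhere dense, subspace
of the hyperplane; there are countably many such `c`, so Baire applies. -/
theorem dense_setOf_generic {ι : Type*} [Fintype ι] {w : ι → ℝ} (hw : w ≠ 0)
    (K : Subfield ℝ) [Countable K] :
    Dense {L : LinearMap.ker (Fintype.linearCombination ℝ w) |
      ∀ c : ι → K, ∑ i, (c i : ℝ) * L.1 i = 0 → ∃ r : ℝ, ∀ i, (c i : ℝ) = r * w i} := by
  classical
  let N : (ι → K) → Submodule ℝ (LinearMap.ker (Fintype.linearCombination ℝ w)) := fun c =>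
    LinearMap.ker ((Fintype.linearCombination ℝ fun i => (c i : ℝ)).domRestrict _)
  have hmem : ∀ c L, L ∈ N c ↔ ∑ i, (c i : ℝ) * L.1 i = 0 := fun c L => by
    simp [N, Fintype.linearCombination_apply, mul_comm]
  have hN : ∀ c, ¬ (∃ r : ℝ, ∀ i, (c i : ℝ) = r * w i) → N c ≠ ⊤ := by
    intro c hc htop
    obtain ⟨i₀, hi₀⟩ := Function.ne_iff.1 hw
    simp only [Pi.zero_apply] at hi₀
    refine hc ⟨c i₀ / w i₀, fun i => ?_⟩
    -- This vector is orthogonal to `w`; its pairing with `c` vanishes only if `c i * w i₀ = c i₀ *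
    -- w i`.
    let L : LinearMap.ker (Fintype.linearCombination ℝ w) :=
      ⟨Pi.single i (w i₀) - Pi.single i₀ (w i), by
        rw [LinearMap.mem_ker, map_sub, Fintype.linearCombination_apply_single,
          Fintype.linearCombination_apply_single, smul_eq_mul, smul_eq_mul, mul_comm, sub_self]⟩
    have h1 : L ∈ N c := htop ▸ Submodule.mem_top
    have h2 : (Fintype.linearCombination ℝ fun i => (c i : ℝ)) L.1 = 0 := h1
    rw [map_sub, Fintype.linearCombination_apply_single,
      Fintype.linearCombination_apply_single, smul_eq_mul, smul_eq_mul] at h2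
    field_simp
    linarith
  have heq : {L : LinearMap.ker (Fintype.linearCombination ℝ w) |
      ∀ c : ι → K, ∑ i, (c i : ℝ) * L.1 i = 0 → ∃ r : ℝ, ∀ i, (c i : ℝ) = r * w i} =
      ⋂ c : {c : ι → K // ¬ ∃ r : ℝ, ∀ i, (c i : ℝ) = r * w i}, (N c.1 : Set _)ᶜ := by
    ext L
    simp only [Set.mem_ofPred_eq, Set.mem_iInter, Set.mem_compl_iff, SetLike.mem_coe, hmem,
      Subtype.forall]
    exact forall_congr' fun c => ⟨fun h hc h0 => hc (h h0), fun h h0 => by_contra fun hc => h hc h0⟩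
  rw [heq]
  refine dense_iInter_of_isOpen (fun c => (N c.1).closed_of_finiteDimensional.isOpen_compl)
    fun c => ?_
  rw [← interior_eq_empty_iff_dense_compl, ← Set.not_nonempty_iff_eq_empty]
  exact fun hne => hN c.1 c.2 (Submodule.eq_top_of_nonempty_interior' _ hne)

/-! ### Construction of forcings -/

theorem exists_int_primitive (u : ℤ → ℝ) (c : ℝ) :
    ∃ X : ℤ → ℝ, X 0 = c ∧ ∀ i, X (i + 1) = X i + u i := by
  let X : ℤ → ℝ
    | Int.ofNat n => c + ∑ j ∈ Finset.range n, u j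
    | Int.negSucc n => c - ∑ j ∈ Finset.range (n + 1), u (Int.negSucc j)
  have h0 : X 0 = c := by
    change c + ∑ j ∈ Finset.range 0, u j = c
    simp
  refine ⟨X, h0, ?_⟩
  rintro (n | n)
  · change c + ∑ j ∈ Finset.range (n + 1), u j = c + ∑ j ∈ Finset.range n, u j + u n
    rw [Finset.sum_range_succ, add_assoc]
  · rcases n with - | n
    · change X 0 = c - ∑ j ∈ Finset.range (0 + 1), u (Int.negSucc j) + u (Int.negSucc 0)
      rw [h0]; simp
    · change c - ∑ j ∈ Finset.range (n + 1), u (Int.negSucc j) =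
        c - ∑ j ∈ Finset.range (n + 1 + 1), u (Int.negSucc j) + u (Int.negSucc (n + 1))
      rw [Finset.sum_range_succ _ (n + 1)]; ring

theorem apply_add_period_of_primitive {k : ℕ} {u X : ℤ → ℝ} (hu : ∀ i, u (i + k) = u i)
    (hX : ∀ i, X (i + 1) = X i + u i) (i : ℤ) :
    X (i + k) = X i + ∑ j ∈ Finset.range k, u j := by
  have hstep : ∀ i, X (i + 1 + k) - X (i + 1) = X (i + k) - X i := fun i => by
    rw [show i + 1 + k = i + k + 1 by ring, hX, hX, hu]; ring
  have hzero : ∀ n : ℕ, X n = X 0 + ∑ j ∈ Finset.range n, u j := fun n => by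
    induction n with
    | zero => simp
    | succ n ih => push_cast; rw [hX, ih, Finset.sum_range_succ, add_assoc]
  have hconst : X (i + k) - X i = X (0 + k) - X 0 := by
    induction i using Int.induction_on with
    | zero => rfl
    | succ i ih => rw [hstep, ih]
    | pred i ih => rw [← ih, ← hstep (-(i : ℤ) - 1), sub_add_cancel]
  rw [zero_add, hzero k] at hconst
  linarith

/-- The values at break points are accumulated from the increments; `hsum` makes them periodic. -/
theorem exists_isPLWith_of_breaks_slopes {k : ℕ} {x w : ℤ → ℝ} (hx : StrictMono x)
    (hxk : ∀ i, x (i + k) = x i + 1) (hwk : ∀ i, w (i + k) = w i) (hne : ∀ i, w (i + 1) ≠ w i)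
    (hsum : ∑ i ∈ Finset.range k, w i * (x (i + 1) - x i) = 0) (c : ℝ) :
    ∃ φ : ℝ → ℝ, Function.Periodic φ 1 ∧ φ (x 0) = c ∧ IsPLWith k φ x w := by
  obtain ⟨v, hv0, hv⟩ := exists_int_primitive (fun i => w i * (x (i + 1) - x i)) c
  have hvk : ∀ i, v (i + k) = v i := fun i => by
    rw [apply_add_period_of_primitive (fun i => ?_) hv, hsum, add_zero]
    rw [add_right_comm, hxk, hxk, hwk]; ring
  choose r hr using hx.exists_mem_Ico_of_add_period hxk
  set φ : ℝ → ℝ := fun t => v (r t) + w (r t) * (t - x (r t)) with hφ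
  have hIco : ∀ i, ∀ t ∈ Set.Ico (x i) (x (i + 1)), φ t = v i + w i * (t - x i) :=
    fun i t ht => by simp only [hφ, hx.eq_of_mem_Ico (hr t) ht]
  have hbreak : ∀ i, φ (x i) = v i := fun i => by
    simpa using hIco i (x i) ⟨le_rfl, hx (lt_add_one i)⟩
  refine ⟨φ, fun t => ?_, (hbreak 0).trans hv0, hx, hxk, hwk, hne, fun i t ht => ?_⟩
  · have h1 : t + 1 ∈ Set.Ico (x (r t + k)) (x (r t + k + 1)) := by
      rw [add_right_comm, hxk, hxk]
      exact ⟨by linarith [(hr t).1], by linarith [(hr t).2]⟩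
    rw [hIco _ _ h1, hIco _ _ (hr t), hvk, hwk, hxk]
    ring
  · rw [hbreak]
    rcases ht.2.lt_or_eq with hlt | rfl
    · exact hIco i t ⟨ht.1, hlt⟩
    · rw [hbreak, hv]

/-! ### Slopes of standard-like forcings -/

namespace IsPLWith

variable {k : ℕ} {φ : ℝ → ℝ} {x w : ℤ → ℝ}

theorem mul_sub_le_sub (h : IsPLWith k φ x w) {c : ℝ} (hc : ∀ i, c ≤ w i) {y z : ℝ} (hyz : y ≤ z) :
    c * (z - y) ≤ φ z - φ y := by
  have hmono : Monotone fun i => φ (x i) - c * x i := monotone_int_of_le_succ fun i => by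
    have h1 := mul_le_mul_of_nonneg_right (hc i) (sub_pos.2 (h.strictMono (lt_add_one i))).le
    rw [h.apply_succ]
    linarith
  obtain ⟨i, hi⟩ := h.strictMono.exists_mem_Ico_of_add_period h.break_add y
  obtain ⟨j, hj⟩ := h.strictMono.exists_mem_Ico_of_add_period h.break_add z
  have hij : i ≤ j := Int.lt_add_one_iff.1 (h.strictMono.lt_iff_lt.1 (hi.1.trans_lt
    (hyz.trans_lt hj.2)))
  have hy := h.affine i y ⟨hi.1, hi.2.le⟩
  have hz := h.affine j z ⟨hj.1, hj.2.le⟩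
  rcases hij.eq_or_lt with rfl | hlt
  · rw [hy, hz]
    linarith [mul_le_mul_of_nonneg_right (hc i) (sub_nonneg.2 hyz)]
  · have h1 := hmono (Int.add_one_le_iff.2 hlt)
    have h2 := mul_le_mul_of_nonneg_right (hc i) (sub_pos.2 hi.2).le
    have h3 := mul_le_mul_of_nonneg_right (hc j) (sub_nonneg.2 hj.1)
    have h4 := h.apply_succ i
    simp only at h1
    linarith

theorem exists_forall_slope_le (h : IsPLWith k φ x w) : ∃ i, ∀ j, w i ≤ w j := by
  have hk := h.period_pos
  obtain ⟨i, -, hi⟩ := (Finset.Ico (0 : ℤ) k).exists_min_image w ⟨0, by simpa using hk⟩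
  refine ⟨i, fun j => ?_⟩
  have h1 : w (j % k) = w j := by
    have := apply_add_zsmul_period (S := 0) (fun i => by simpa using h.slope_add i) (j % k) (j / k)
    rw [Int.emod_add_ediv_mul] at this
    simpa using this.symm
  rw [← h1]
  exact hi _ (Finset.mem_Ico.2 ⟨Int.emod_nonneg _ (by omega), Int.emod_lt_of_pos _ (by omega)⟩)

theorem circleFamily_apply_succ (h : IsPLWith k φ x w) (b ω : ℝ) (i : ℤ) :
    circleFamily b ω φ (x (i + 1)) =
      circleFamily b ω φ (x i) + (1 + b * w i) * (x (i + 1) - x i) := by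
  simp only [circleFamily, h.apply_succ i]; ring

/-- The slopes of the family are `1 + b * w i`, so the coupling at which monotonicity is lost is
determined by the least slope. -/
theorem isStandardLike_iff (h : IsPLWith k φ x w) :
    IsStandardLike φ ↔ (∀ i, -1 ≤ w i) ∧ ∃ i, w i = -1 := by
  constructor
  · intro hs
    have hge : ∀ i, -1 ≤ w i := fun i => by
      by_contra! hlt
      have hx := h.strictMono (lt_add_one i)
      -- This coupling flattens the interval `i`, and it is below 1 if `w i < -1`.
      have h1 := hs.strictMono_of_lt_one (-(w i)⁻¹) 0 (by
        rw [neg_nonneg, inv_nonpos]; linarith) (by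
        rw [← inv_neg]; exact inv_lt_one_of_one_lt₀ (by linarith)) hx
      rw [h.circleFamily_apply_succ, neg_mul, inv_mul_cancel₀ (by linarith)] at h1
      simp at h1
    refine ⟨hge, ?_⟩
    obtain ⟨i, hi⟩ := h.exists_forall_slope_le
    refine ⟨i, ((hge i).antisymm ?_).symm⟩
    by_contra! hlt
    obtain ⟨b, hb1, hb⟩ : ∃ b : ℝ, 1 < b ∧ 0 ≤ 1 + b * w i := by
      rcases le_or_gt 0 (w i) with h0 | h0
      · exact ⟨2, one_lt_two, by linarith⟩
      · refine ⟨(-w i)⁻¹, (one_lt_inv₀ (by linarith)).2 (by linarith), ?_⟩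
        rw [inv_neg, neg_mul, inv_mul_cancel₀ h0.ne]; simp
    refine hs.not_monotone_of_one_lt b 0 hb1 fun y z hyz => ?_
    have h1 := h.mul_sub_le_sub hi hyz
    have h2 := mul_le_mul_of_nonneg_left h1 (zero_le_one.trans hb1.le)
    have h3 := mul_nonneg hb (sub_nonneg.2 hyz)
    simp only [circleFamily]
    linarith
  · rintro ⟨hge, i, hi⟩
    refine ⟨fun b ω hb0 hb1 y z hyz => ?_, fun b ω hb hmono => ?_⟩
    · have h1 := mul_le_mul_of_nonneg_left (h.mul_sub_le_sub hge hyz.le) hb0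
      have h2 := mul_pos (sub_pos.2 hb1) (sub_pos.2 hyz)
      simp only [circleFamily]
      linarith
    · have hx := h.strictMono (lt_add_one i)
      have h1 := hmono hx.le
      rw [h.circleFamily_apply_succ, hi] at h1
      have h2 := mul_pos (sub_pos.2 hb) (sub_pos.2 hx)
      linarith

end IsPLWith

/-! ### Density -/

namespace MarkedPLForcing

variable {k : ℕ}

theorem sum_lengths (m : MarkedPLForcing k) :
    ∑ i : Fin k, (m.breaks ((i : ℕ) + 1) - m.breaks (i : ℕ)) = 1 := by
  rw [Fin.sum_univ_eq_sum_range (fun i : ℕ => m.breaks (i + 1) - m.breaks i)]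
  have h1 := Finset.sum_range_sub (fun i : ℕ => m.breaks i) k
  have h2 := m.isPLWith.break_add 0
  push_cast at h1
  rw [zero_add] at h2
  rw [h1, h2]; ring

theorem sum_slopes_mul_lengths (m : MarkedPLForcing k) :
    ∑ i : Fin k, (m.breaks ((i : ℕ) + 1) - m.breaks (i : ℕ)) * m.slopes (i : ℕ) = 0 := by
  rw [Fin.sum_univ_eq_sum_range
    (fun i : ℕ => (m.breaks (i + 1) - m.breaks i) * m.slopes i)]
  have h1 := Finset.sum_range_sub (fun i : ℕ => m.forcing.toFun (m.breaks i)) k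
  have h2 := m.isPLWith.break_add 0
  push_cast at h1
  rw [zero_add] at h2
  rw [h2, m.forcing.periodic, sub_self] at h1
  rw [← h1]
  refine Finset.sum_congr rfl fun i _ => ?_
  rw [m.isPLWith.apply_succ]; ring

theorem breaks_eq_sum (m : MarkedPLForcing k) (i : Fin k) :
    m.breaks (i : ℕ) = m.breaks 0 +
      ∑ j ∈ Finset.Iio i, (m.breaks ((j : ℕ) + 1) - m.breaks (j : ℕ)) := by
  have h1 := Finset.sum_range_sub (fun i : ℕ => m.breaks i) i
  rw [← Nat.Iio_eq_range, ← Fin.map_valEmbedding_Iio, Finset.sum_map] at h1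
  push_cast [Fin.valEmbedding_apply] at h1
  rw [h1]; ring

/-- The lengths of the intervals between break points can be prescribed freely, subject to the
two obvious linear conditions. -/
theorem exists_lengths_eq (m : MarkedPLForcing k) {L : Fin k → ℝ} (hpos : ∀ i, 0 < L i)
    (hsum : ∑ i, L i = 1) (horth : ∑ i, L i * m.slopes (i : ℕ) = 0) :
    ∃ m' : MarkedPLForcing k, m'.slopes = m.slopes ∧
      (∀ i : Fin k, m'.breaks ((i : ℕ) + 1) - m'.breaks (i : ℕ) = L i) ∧
      m'.breaks 0 = m.breaks 0 ∧
      m'.forcing.toFun (m'.breaks 0) = m.forcing.toFun (m.breaks 0) := by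
  have hk := m.isPLWith.period_pos
  let u : ℤ → ℝ := fun i => L ⟨(i % k).toNat, by
    have := Int.emod_lt_of_pos i (b := k) (by omega); omega⟩
  have hu : ∀ i : Fin k, u (i : ℕ) = L i := fun i => by
    simp only [u]
    congr 1
    apply Fin.ext
    simp only
    rw [Int.emod_eq_of_lt (by omega) (by omega)]; simp
  have huk : ∀ i, u (i + k) = u i := fun i => by simp [u]
  obtain ⟨X, hX0, hX⟩ := exists_int_primitive u (m.breaks 0)
  have hXL : ∀ i : Fin k, X ((i : ℕ) + 1) - X (i : ℕ) = L i := fun i => by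
    rw [hX, hu, add_sub_cancel_left]
  have hXk : ∀ i, X (i + k) = X i + 1 := fun i => by
    rw [apply_add_period_of_primitive huk hX, ← hsum,
      ← Fin.sum_univ_eq_sum_range (fun i : ℕ => u i)]
    simp only [hu]
  have hmono : StrictMono X := strictMono_int_of_lt_succ fun i => by
    rw [hX]; linarith [hpos ⟨(i % k).toNat, by
      have := Int.emod_lt_of_pos i (b := k) (by omega); omega⟩]
  have hzero : ∑ i ∈ Finset.range k, m.slopes i * (X (i + 1) - X i) = 0 := by
    rw [← Fin.sum_univ_eq_sum_range (fun i : ℕ => m.slopes i * (X (i + 1) - X i)), ← horth]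
    exact Finset.sum_congr rfl fun i _ => by rw [hXL, mul_comm]
  obtain ⟨φ, hper, hφ0, hPL⟩ := exists_isPLWith_of_breaks_slopes hmono hXk m.isPLWith.slope_add
    m.isPLWith.slope_ne hzero (m.forcing.toFun (m.breaks 0))
  have hstd : IsStandardLike φ := hPL.isStandardLike_iff.2
    (m.isPLWith.isStandardLike_iff.1 m.forcing.standardLike)
  exact ⟨⟨⟨φ, hper, ⟨X, _, hPL⟩, hstd⟩, X, m.slopes, hPL⟩, rfl, hXL, hX0, hφ0⟩

theorem dense_setOf_hasNoPinching (hk : 2 < k) :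
    Dense {m : MarkedPLForcing k | HasNoPinching m.forcing.toFun} := by
  intro m
  rw [closure_induced]
  obtain ⟨K, hKc, hK⟩ := exists_countable_containsCouplings m.slopes
  set w : Fin k → ℝ := fun i => m.slopes (i : ℕ) with hw
  have hw0 : w ≠ 0 := fun h0 => by
    have h1 := congrFun h0 ⟨0, by omega⟩
    have h2 := congrFun h0 ⟨1, by omega⟩
    apply m.isPLWith.slope_ne 0
    simpa [hw] using h2.trans h1.symm
  let V := LinearMap.ker (Fintype.linearCombination ℝ w)
  let L₀ : V := ⟨fun i => m.breaks ((i : ℕ) + 1) - m.breaks (i : ℕ), by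
    rw [LinearMap.mem_ker, Fintype.linearCombination_apply]
    exact m.sum_slopes_mul_lengths⟩
  -- Dividing by the total length restores period 1; membership in the hyperplane and genericity are
  -- unaffected by scaling.
  let Ψ : V → (Fin k → ℝ) × (Fin k → ℝ) × ℝ := fun L =>
    (fun i => m.breaks 0 + ∑ j ∈ Finset.Iio i, L.1 j / ∑ l, L.1 l, w,
      m.forcing.toFun (m.breaks 0))
  have hsum₀ : ∑ l, L₀.1 l = 1 := m.sum_lengths
  have hcoord : ∀ j, Continuous fun L : V => L.1 j := fun j =>
    (continuous_apply j).comp continuous_subtype_val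
  have hΨ₀ : Ψ L₀ = m.coords := by
    refine Prod.ext (funext fun i => ?_) rfl
    simp only [Ψ, hsum₀, div_one]
    exact (m.breaks_eq_sum i).symm
  have hΨ : Filter.Tendsto Ψ (nhds L₀) (nhds m.coords) := by
    rw [← hΨ₀]
    refine ContinuousAt.prodMk (continuousAt_pi.2 fun i => ?_) continuousAt_const
    refine continuousAt_const.add (tendsto_finsetSum _ fun j _ => ?_)
    refine ContinuousAt.div (hcoord j).continuousAt
      (continuous_finsetSum _ fun l _ => hcoord l).continuousAt ?_
    rw [hsum₀]; exact one_ne_zero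
  have hpos : ∀ᶠ L : V in nhds L₀, ∀ i, 0 < L.1 i := Filter.eventually_all.2 fun i =>
    (hcoord i).continuousAt.tendsto.eventually_const_lt (sub_pos.2 (m.isPLWith.strictMono (lt_add_one _)))
  have hgen := (mem_closure_iff_frequently.1 (dense_setOf_generic hw0 K L₀)).and_eventually hpos
  refine mem_closure_of_frequently_of_tendsto (hgen.mono ?_) hΨ
  rintro L ⟨hLgen, hLpos⟩
  have hS : 0 < ∑ l, L.1 l :=
    Finset.sum_pos (fun i _ => hLpos i) ⟨⟨0, by omega⟩, Finset.mem_univ _⟩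
  have hLorth : ∑ i, L.1 i * w i = 0 := by
    have := L.2
    rwa [LinearMap.mem_ker, Fintype.linearCombination_apply] at this
  obtain ⟨m', hslopes, hlen, hbreak, hval⟩ := m.exists_lengths_eq
    (L := fun i => L.1 i / ∑ l, L.1 l) (fun i => div_pos (hLpos i) hS)
    (by rw [← Finset.sum_div, div_self hS.ne'])
    (by simp only [div_mul_eq_mul_div, ← Finset.sum_div]; rw [hLorth, zero_div])
  refine ⟨m', ?_, ?_⟩
  · refine m'.hasNoPinching_of_isGenericLengths hk (K := K) (hslopes ▸ hK) fun c hc => ?_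
    simp only [hlen, hslopes, ← mul_div_assoc, ← Finset.sum_div] at hc ⊢
    exact hLgen c ((div_eq_zero_iff.1 hc).resolve_right hS.ne')
  · refine Prod.ext (funext fun i => ?_) (Prod.ext (funext fun i => ?_) hval)
    · change m'.breaks (i : ℕ) = _
      rw [m'.breaks_eq_sum i, hbreak]
      simp only [hlen, Ψ]
    · change m'.slopes (i : ℕ) = _
      rw [hslopes]

end MarkedPLForcing

theorem mainTheorem3 (k : ℕ) (hk : 2 < k) :
    IsGδ {φ : PLForcing k | HasNoPinching φ.toFun} ∧
      Dense {φ : PLForcing k | HasNoPinching φ.toFun} := by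
  refine ⟨PLForcing.isGδ_setOf_hasNoPinching, ?_⟩
  -- Density passes to the quotient, a continuous surjective image.
  refine (MarkedPLForcing.forcing_surjective.denseRange.dense_image
    MarkedPLForcing.continuous_forcing
    (MarkedPLForcing.dense_setOf_hasNoPinching hk)).mono ?_
  rintro _ ⟨m, hm, rfl⟩
  exact hm
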